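/- Let $m_1,m_2,\lambda_1,\lambda_2\in(0,\infty)$ and $\alpha_1,\alpha_2\in[0,1)$, and let $$\nu_{ts}(du)=\left(\frac{m_1}{u^{1+\alpha_1}}e^{-\lambda_1u}\mathbf 1_{(0,\infty)}(u)+\frac{m_2}{|u|^{1+\alpha_2}}e^{-\lambda_2|u|}\mathbf 1_{(-\infty,0)}(u)\right)du,\qquad \phi_{ts}(z)=\exp\left(\int_{\mathbb R}(e^{izu}-1)\,\nu_{ts}(du)\right),\quad z\in\mathbb R,$$ be the Lévy measure and the characteristic function of the tempered stable distribution with these parameters. Let $\mathcal S(\mathbb R)$ be the Schwartz space of complex-valued functions, $\mathcal F$ its closure, with respect to the supremum norm, in the space of bounded continuous functions $\mathbb R\to\mathbb C$, and $\widehat f(z)=\int_{\mathbb R}e^{-izx}f(x)\,dx$. Then there is a unique family $(P_t)_{t\ge 0}$ of bounded linear operators on $\mathcal F$ such that $$P_tf(x)=\frac1{2\pi}\int_{\mathbb R}\widehat f(z)\,e^{izxe^{-t}}\,\frac{\phi_{ts}(z)}{\phi_{ts}(e^{-t}z)}\,dz,\qquad x\in\mathbb R,\ t\ge0,$$ with an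 absolutely convergent integral, for every $f\in\mathcal F$ for which $f$ and $\widehat f$ are integrable (in particular for every $f\in\mathcal S(\mathbb R)$). Moreover: (i) $(P_t)_{t\ge0}$ is a $C_0$-semigroup on $\mathcal F$: $P_0=I$, $P_{s+t}=P_sP_t$ for all $s,t\ge 0$, and $\|P_tf-f\|_\infty\to0$ as $t\downarrow0$ for every $f\in\mathcal F$. (ii) Let $T$ be its infinitesimal generator, $Tf=\lim_{t\downarrow0}(P_tf-f)/t$ in the supremum norm, defined for all $f\in\mathcal F$ for which the limit exists in $\mathcal F$. Every $f\in\mathcal S(\mathbb R)$ belongs to the domain of $T$, and $$Tf(x)=-xf'(x)+\int_{\mathbb R}u\,f'(x+u)\,\nu_{ts}(du),\qquad x\in\mathbb R,$$ where the integral converges absolutely. -/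

import Mathlib

open MeasureTheory Filter Topology
open scoped NNReal SchwartzMap BoundedContinuousFunction

noncomputable section

namespace TSD

/-- Parameters `m₁, α₁, lam₁, m₂, α₂, lam₂` of a tempered stable distribution. -/
structure Params where
  m₁ : ℝ
  α₁ : ℝ
  lam₁ : ℝ
  m₂ : ℝ
  α₂ : ℝ
  lam₂ : ℝ
  m₁_pos : 0 < m₁
  m₂_pos : 0 < m₂
  lam₁_pos : 0 < lam₁
  lam₂_pos : 0 < lam₂
  α₁_nonneg : 0 ≤ α₁
  α₁_lt_one : α₁ < 1
  α₂_nonneg : 0 ≤ α₂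
  α₂_lt_one : α₂ < 1

/-- Lebesgue density of the Lévy measure. -/
def levyDensity (p : Params) (u : ℝ) : ℝ :=
  if 0 < u then p.m₁ / u ^ (1 + p.α₁) * Real.exp (-p.lam₁ * u)
  else if u < 0 then p.m₂ / |u| ^ (1 + p.α₂) * Real.exp (-p.lam₂ * |u|)
  else 0

/-- The Lévy measure `ν_ts`. -/
def levyMeasure (p : Params) : Measure ℝ :=
  volume.withDensity fun u => ENNReal.ofReal (levyDensity p u)

/-- The characteristic function `φ_ts(z) = exp (∫ (e^{izu} - 1) ν_ts(du))`. -/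
def charFn (p : Params) (z : ℝ) : ℂ :=
  Complex.exp (∫ u : ℝ, (Complex.exp (Complex.I * z * u) - 1) ∂(levyMeasure p))

/-- The Fourier transform `∫ e^{-iux} f(x) dx`. -/
def fourierT (f : ℝ → ℂ) (u : ℝ) : ℂ :=
  ∫ x : ℝ, Complex.exp (-(Complex.I * u * x)) * f x

/-- The integrand of the formula for `P_t f(x)`. -/
def semigroupIntegrand (p : Params) (t : ℝ≥0) (f : ℝ → ℂ) (x z : ℝ) : ℂ :=
  fourierT f z * Complex.exp (Complex.I * z * x * Real.exp (-(t : ℝ))) *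
    (charFn p z / charFn p (Real.exp (-(t : ℝ)) * z))

/-- The closure of the Schwartz space in the bounded continuous functions with the
supremum norm. -/
def schwartzClosure : Submodule ℂ (ℝ →ᵇ ℂ) :=
  (LinearMap.range
    (SchwartzMap.toBoundedContinuousFunctionCLM ℂ ℝ ℂ : 𝓢(ℝ, ℂ) →ₗ[ℂ] (ℝ →ᵇ ℂ))).topologicalClosure

/-- A Schwartz function as an element of the closure of the Schwartz space. -/
def ofSchwartz (f : 𝓢(ℝ, ℂ)) : schwartzClosure :=
  ⟨SchwartzMap.toBoundedContinuousFunctionCLM ℂ ℝ ℂ f,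
    Submodule.le_topologicalClosure _ ⟨f, rfl⟩⟩

/-- `P t` is given by the integral formula at every function of the closure of the Schwartz space
for which that formula makes sense classically, that is, every `f` such that `f` and its Fourier
transform are integrable; the Schwartz functions are among these. -/
def IsGivenByFormula (p : Params)
    (P : ℝ≥0 → (schwartzClosure →L[ℂ] schwartzClosure)) : Prop :=
  ∀ (t : ℝ≥0) (f : schwartzClosure),
    Integrable (f : ℝ →ᵇ ℂ) → Integrable (fourierT (f : ℝ →ᵇ ℂ)) →
    ∀ x : ℝ, Integrable (semigroupIntegrand p t (f : ℝ →ᵇ ℂ) x) ∧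
      (P t f : ℝ →ᵇ ℂ) x =
        1 / (2 * (Real.pi : ℂ)) * ∫ z : ℝ, semigroupIntegrand p t (f : ℝ →ᵇ ℂ) x z

section Semigroup

variable {E : Type*} [NormedAddCommGroup E] [NormedSpace ℂ E]

/-- Strongly continuous one-parameter semigroups of bounded linear operators. -/
structure IsC0Semigroup (P : ℝ≥0 → (E →L[ℂ] E)) : Prop where
  zero : P 0 = ContinuousLinearMap.id ℂ E
  add : ∀ s t : ℝ≥0, P (s + t) = (P s).comp (P t)
  tendsto_zero : ∀ f : E, Tendsto (fun t : ℝ≥0 => P t f) (𝓝[>] 0) (𝓝 f)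

/-- `g` is the norm limit of `(P t f - f) / t` as `t ↓ 0`. -/
def HasGeneratorAt (P : ℝ≥0 → (E →L[ℂ] E)) (f g : E) : Prop :=
  Tendsto (fun t : ℝ≥0 => (((t : ℝ) : ℂ)⁻¹) • (P t f - f)) (𝓝[>] 0) (𝓝 g)

theorem HasGeneratorAt.add {P : ℝ≥0 → (E →L[ℂ] E)} {f g f' g' : E}
    (h : HasGeneratorAt P f g) (h' : HasGeneratorAt P f' g') :
    HasGeneratorAt P (f + f') (g + g') := by
  refine (Tendsto.add h h').congr fun t => ?_
  rw [← smul_add, map_add]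
  congr 1
  abel

theorem HasGeneratorAt.smul {P : ℝ≥0 → (E →L[ℂ] E)} {f g : E} (c : ℂ)
    (h : HasGeneratorAt P f g) : HasGeneratorAt P (c • f) (c • g) := by
  refine (Tendsto.const_smul h c).congr fun t => ?_
  rw [map_smul, ← smul_sub, smul_comm]

theorem HasGeneratorAt.zero (P : ℝ≥0 → (E →L[ℂ] E)) : HasGeneratorAt P 0 0 := by
  simp [HasGeneratorAt]

theorem HasGeneratorAt.unique {P : ℝ≥0 → (E →L[ℂ] E)} {f g g' : E}
    (h : HasGeneratorAt P f g) (h' : HasGeneratorAt P f g') : g = g' :=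
  tendsto_nhds_unique h h'

/-- The infinitesimal generator, with its maximal domain. -/
def generator (P : ℝ≥0 → (E →L[ℂ] E)) : E →ₗ.[ℂ] E where
  domain :=
    { carrier := {f | ∃ g, HasGeneratorAt P f g}
      add_mem' := fun ⟨_, h⟩ ⟨_, h'⟩ => ⟨_, h.add h'⟩
      zero_mem' := ⟨0, HasGeneratorAt.zero P⟩
      smul_mem' := fun c _ ⟨_, h⟩ => ⟨_, h.smul c⟩ }
  toFun :=
    { toFun := fun f => Classical.choose f.2
      map_add' := fun f f' => (Classical.choose_spec (f + f').2).unique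
        ((Classical.choose_spec f.2).add (Classical.choose_spec f'.2))
      map_smul' := fun c f => (Classical.choose_spec (c • f).2).unique
        ((Classical.choose_spec f.2).smul c) }

theorem hasGeneratorAt_generator (P : ℝ≥0 → (E →L[ℂ] E)) (f : (generator P).domain) :
    HasGeneratorAt P f (generator P f) :=
  Classical.choose_spec f.2

end Semigroup

end TSD

end

open scoped FourierTransform

noncomputable section

namespace TSD

/-! ### The inverse Fourier transform of integrable functions -/

/-! Everything is done on the Fourier side. Write `f = invF h` with `h` integrable and put `c =
e^t`. The substitution `z = c w` turns the defining formula into `P_t (invF h) = invF (evol p c h)`,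
where the quotients of `charFn` telescope, so the semigroup law is immediate on functions of this
form.

The point that needs an argument is boundedness in the supremum norm. Since `c ν(cu) ≤ ν(u)` for the
Lévy density when `c ≥ 1` (`mul_levyDensity_mul_le`), the quotient `φ(z)/φ(z/c)` is the exponential
of a Lévy–Khintchine integral with nonnegative density `ν(u) - c ν(cu)`. Such an exponential is a
limit of powers of Fourier transforms of probability measures. Multiplying `h` by one of these
averages translates of `invF h`, which is a contraction, and contractivity survives products and
pointwise limits (`IsContractive`). Hence no limiting measure has to be constructed. Functions `invF
h` are dense, so `P_t` extends to a contraction. Fourier inversion gives the formula, and density of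
Schwartz functions gives uniqueness.

The L¹ norm of `h` dominates the supremum norm of `invF h`, so the generator on Schwartz functions
follows from L¹ convergence of difference quotients of `evol` (`tendsto_integral_norm_evol`). The
limit `genDensity` is carried back to the space variable by an integration by parts and Fubini
(`invF_genDensity`). Strong continuity follows from differentiability on this dense set together
with contractivity. -/

/-- The functions `x ↦ ∫ h(z) e^{izx} dz`. -/
def invF (h : ℝ → ℂ) (x : ℝ) : ℂ :=
  ∫ z : ℝ, h z * Complex.exp (Complex.I * z * x)

theorem norm_exp_I_mul_mul (z x : ℝ) : ‖Complex.exp (Complex.I * z * x)‖ = 1 := by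
  rw [show Complex.I * z * x = ((z * x : ℝ) : ℂ) * Complex.I by push_cast; ring]
  exact Complex.norm_exp_ofReal_mul_I _

theorem integrable_mul_exp {h : ℝ → ℂ} (hh : Integrable h) (x : ℝ) :
    Integrable fun z : ℝ => h z * Complex.exp (Complex.I * z * x) := by
  refine hh.mul_bdd (c := 1) (by fun_prop) (ae_of_all _ fun z => ?_)
  rw [norm_exp_I_mul_mul]

theorem norm_invF_le (h : ℝ → ℂ) (x : ℝ) : ‖invF h x‖ ≤ ∫ z, ‖h z‖ := by
  refine (norm_integral_le_integral_norm _).trans_eq ?_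
  simp only [norm_mul, norm_exp_I_mul_mul, mul_one]

theorem invF_add {h k : ℝ → ℂ} (hh : Integrable h) (hk : Integrable k) (x : ℝ) :
    invF (h + k) x = invF h x + invF k x := by
  simp only [invF, Pi.add_apply, add_mul]
  exact integral_add (integrable_mul_exp hh x) (integrable_mul_exp hk x)

theorem invF_sub {h k : ℝ → ℂ} (hh : Integrable h) (hk : Integrable k) (x : ℝ) :
    invF (h - k) x = invF h x - invF k x := by
  simp only [invF, Pi.sub_apply, sub_mul]
  exact integral_sub (integrable_mul_exp hh x) (integrable_mul_exp hk x)

theorem invF_smul (c : ℂ) (h : ℝ → ℂ) (x : ℝ) : invF (c • h) x = c * invF h x := by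
  simp only [invF, Pi.smul_apply, smul_eq_mul, mul_assoc]
  exact integral_const_mul _ _

theorem continuous_invF {h : ℝ → ℂ} (hh : Integrable h) : Continuous (invF h) := by
  refine continuous_of_dominated (bound := fun z => ‖h z‖)
    (fun x => (integrable_mul_exp hh x).aestronglyMeasurable)
    (fun x => ae_of_all _ fun z => ?_) hh.norm (ae_of_all _ fun z => by fun_prop)
  rw [norm_mul, norm_exp_I_mul_mul, mul_one]

theorem invF_eq_fourierInv (h : ℝ → ℂ) (x : ℝ) : invF h x = 𝓕⁻ h (x / (2 * Real.pi)) := by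
  rw [Real.fourierInv_eq']
  refine integral_congr_ae (ae_of_all _ fun z => ?_)
  have := Real.pi_ne_zero
  have h2 : (Real.pi : ℂ) ≠ 0 := by exact_mod_cast this
  simp only [smul_eq_mul]
  rw [mul_comm]
  congr 2
  simp
  field_simp

theorem fourierT_eq_fourier (f : ℝ → ℂ) (u : ℝ) : fourierT f u = 𝓕 f (u / (2 * Real.pi)) := by
  rw [Real.fourier_eq']
  refine integral_congr_ae (ae_of_all _ fun z => ?_)
  have h2 : (Real.pi : ℂ) ≠ 0 := by exact_mod_cast Real.pi_ne_zero
  simp only [smul_eq_mul]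
  congr 2
  simp
  field_simp

/-- Fourier inversion in the normalisation of `fourierT`. -/
theorem invF_fourierT {f : ℝ → ℂ} (hc : Continuous f) (hf : Integrable f)
    (hf' : Integrable (fourierT f)) (x : ℝ) :
    invF ((1 / (2 * (Real.pi : ℂ))) • fourierT f) x = f x := by
  have hpi : (2 * Real.pi) ≠ 0 := by positivity
  have hF : Integrable (𝓕 f) := by
    refine (hf'.comp_mul_left' hpi).congr (ae_of_all _ fun u => ?_)
    simp only [fourierT_eq_fourier, mul_div_cancel_left₀ _ hpi]
  have key := congrFun (hc.fourierInv_fourier_eq hf hF) x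
  rw [invF_smul, ← key, Real.fourierInv_eq']
  have h1 := Measure.integral_comp_div
    (fun v : ℝ => Complex.exp (↑(2 * Real.pi * inner ℝ v x) * Complex.I) • 𝓕 f v) (2 * Real.pi)
  have h2 : invF (fourierT f) x = ∫ z : ℝ,
      Complex.exp (↑(2 * Real.pi * inner ℝ (z / (2 * Real.pi)) x) * Complex.I) •
        𝓕 f (z / (2 * Real.pi)) := by
    refine integral_congr_ae (ae_of_all _ fun z => ?_)
    have h2 : (Real.pi : ℂ) ≠ 0 := by exact_mod_cast Real.pi_ne_zero
    simp only [smul_eq_mul]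
    rw [mul_comm, fourierT_eq_fourier]
    congr 2
    simp
    field_simp
  rw [h2, h1, abs_of_pos (by positivity), Complex.real_smul, ← mul_assoc]
  have h2 : (Real.pi : ℂ) ≠ 0 := by exact_mod_cast Real.pi_ne_zero
  rw [show (1 / (2 * (Real.pi : ℂ)) * ((2 * Real.pi : ℝ) : ℂ)) = 1 by push_cast; field_simp, one_mul]

/-- Dilation of a Schwartz function. -/
def dilate (c : ℝˣ) : 𝓢(ℝ, ℂ) →L[ℂ] 𝓢(ℝ, ℂ) :=
  SchwartzMap.compCLMOfContinuousLinearEquiv ℂ (ContinuousLinearEquiv.unitsEquivAut ℝ c)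

theorem dilate_apply (c : ℝˣ) (f : 𝓢(ℝ, ℂ)) (x : ℝ) : dilate c f x = f (x * c) := rfl

/-- `2π` as a unit. -/
def twoPi : ℝˣ := Units.mk0 (2 * Real.pi) (by positivity)

theorem invF_schwartz (h : 𝓢(ℝ, ℂ)) (x : ℝ) : invF h x = dilate twoPi⁻¹ (𝓕⁻ h) x := by
  rw [invF_eq_fourierInv, dilate_apply, SchwartzMap.fourierInv_coe]
  rfl

theorem exists_schwartz_invF_eq (f : 𝓢(ℝ, ℂ)) : ∃ h : 𝓢(ℝ, ℂ), ∀ x, invF h x = f x := by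
  -- `invF` is the inverse of `𝓕` followed by dilation by `1/(2π)`; dilating by `2π` beforehand
  -- cancels it.
  refine ⟨𝓕 (dilate twoPi f), fun x => ?_⟩
  rw [invF_schwartz, FourierTransform.fourierInv_fourier_eq, dilate_apply, dilate_apply]
  simp

theorem exists_schwartz_integral_norm_sub_lt {h : ℝ → ℂ} (hh : Integrable h) {ε : ℝ}
    (hε : 0 < ε) : ∃ k : 𝓢(ℝ, ℂ), ∫ z, ‖h z - k z‖ < ε := by
  obtain ⟨k, hk⟩ := (SchwartzMap.denseRange_toLpCLM (E := ℝ) (F := ℂ) (p := 1) (μ := volume)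
    ENNReal.one_ne_top).exists_dist_lt (hh.toL1 h) hε
  refine ⟨k, ?_⟩
  rw [dist_eq_norm, L1.norm_eq_integral_norm] at hk
  refine lt_of_eq_of_lt (integral_congr_ae ?_) hk
  filter_upwards [Lp.coeFn_sub (hh.toL1 h) (SchwartzMap.toLpCLM ℝ ℂ 1 volume k),
    hh.coeFn_toL1, SchwartzMap.coeFn_toLp k 1 volume] with z h1 h2 h3
  rw [h1, Pi.sub_apply, h2]
  erw [h3]

/-- The integrable functions `ℝ → ℂ`. -/
def integrableFun : Submodule ℂ (ℝ → ℂ) where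
  carrier := {h | Integrable h volume}
  add_mem' := fun h k => Integrable.add h k
  zero_mem' := integrable_zero _ _ _
  smul_mem' := fun c _ h => Integrable.smul c h

/-- `invF h` as a bounded continuous function. -/
def invFBCF (h : integrableFun) : ℝ →ᵇ ℂ :=
  BoundedContinuousFunction.ofNormedAddCommGroup (invF h) (continuous_invF h.2)
    (∫ z, ‖(h : ℝ → ℂ) z‖) (norm_invF_le h)

/-- Schwartz functions are dense in L¹, `invF` maps them to Schwartz functions, and L¹ distance
before `invF` bounds uniform distance after it. -/
theorem invFBCF_mem (h : integrableFun) : invFBCF h ∈ schwartzClosure := by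
  rw [schwartzClosure, ← SetLike.mem_coe, Submodule.topologicalClosure_coe, Metric.mem_closure_iff]
  intro ε hε
  obtain ⟨k, hk⟩ := exists_schwartz_integral_norm_sub_lt h.2 hε
  refine ⟨SchwartzMap.toBoundedContinuousFunctionCLM ℂ ℝ ℂ (dilate twoPi⁻¹ (𝓕⁻ k)),
    ⟨_, rfl⟩, ?_⟩
  refine lt_of_le_of_lt ?_ hk
  rw [BoundedContinuousFunction.dist_le (integral_nonneg fun _ => norm_nonneg _)]
  intro x
  change dist (invF h x) (dilate twoPi⁻¹ (𝓕⁻ k) x) ≤ _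
  rw [← invF_schwartz, dist_eq_norm, ← invF_sub h.2 k.integrable]
  exact norm_invF_le _ _

/-- `invF` as a linear map into the closure of the Schwartz space. -/
def invFMap : integrableFun →ₗ[ℂ] schwartzClosure where
  toFun h := ⟨invFBCF h, invFBCF_mem h⟩
  map_add' h k := by
    ext x
    exact invF_add h.2 k.2 x
  map_smul' c h := by
    ext x
    exact invF_smul c h x

theorem invFMap_apply (h : integrableFun) (x : ℝ) : (invFMap h : ℝ →ᵇ ℂ) x = invF h x := rfl

theorem norm_le_of_forall_le {f : schwartzClosure} {C : ℝ} (hC : 0 ≤ C)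
    (h : ∀ x, ‖(f : ℝ →ᵇ ℂ) x‖ ≤ C) : ‖f‖ ≤ C :=
  (BoundedContinuousFunction.norm_le hC).2 h

theorem norm_invFMap_le (h : integrableFun) : ‖invFMap h‖ ≤ ∫ z, ‖(h : ℝ → ℂ) z‖ :=
  norm_le_of_forall_le (integral_nonneg fun _ => norm_nonneg _) (norm_invF_le h)

theorem denseRange_ofSchwartz : DenseRange ofSchwartz := by
  rintro ⟨f, hf⟩
  have hf' := hf
  rw [schwartzClosure, ← SetLike.mem_coe, Submodule.topologicalClosure_coe,
    Metric.mem_closure_iff] at hf'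
  rw [Metric.mem_closure_iff]
  intro ε hε
  obtain ⟨_, ⟨k, rfl⟩, hk⟩ := hf' ε hε
  exact ⟨ofSchwartz k, ⟨k, rfl⟩, hk⟩

theorem exists_invFMap_eq_ofSchwartz (f : 𝓢(ℝ, ℂ)) :
    ∃ h : 𝓢(ℝ, ℂ), invFMap ⟨h, h.integrable⟩ = ofSchwartz f := by
  obtain ⟨h, hh⟩ := exists_schwartz_invF_eq f
  exact ⟨h, Subtype.ext (BoundedContinuousFunction.ext hh)⟩

theorem denseRange_invFMap : DenseRange invFMap := by
  refine denseRange_ofSchwartz.mono ?_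
  rintro _ ⟨f, rfl⟩
  obtain ⟨h, hh⟩ := exists_invFMap_eq_ofSchwartz f
  exact ⟨_, hh⟩

instance : CompleteSpace schwartzClosure :=
  (Submodule.isClosed_topologicalClosure _).completeSpace_coe

/-! ### The Lévy density -/

/-- One half of the Lévy density. -/
def sideDensity (m α lam u : ℝ) : ℝ := m / u ^ (1 + α) * Real.exp (-lam * u)

theorem sideDensity_nonneg {m α lam u : ℝ} (hm : 0 < m) (hu : 0 < u) :
    0 ≤ sideDensity m α lam u := by
  unfold sideDensity
  positivity

/-- The power part scales by `c / c^(1+α) = c^(-α) ≤ 1`, and the exponential part decreases. -/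
theorem mul_sideDensity_mul_le {m α lam u c : ℝ} (hm : 0 < m) (hα : 0 ≤ α) (hlam : 0 < lam)
    (hu : 0 < u) (hc : 1 ≤ c) : c * sideDensity m α lam (c * u) ≤ sideDensity m α lam u := by
  have hc0 : 0 < c := by linarith
  unfold sideDensity
  rw [← mul_assoc]
  refine mul_le_mul ?_ ?_ (Real.exp_pos _).le (by positivity)
  · rw [Real.mul_rpow hc0.le hu.le, mul_div_assoc', div_le_div_iff₀ (by positivity) (by positivity)]
    have h1 : c ≤ c ^ (1 + α) := by
      conv_lhs => rw [← Real.rpow_one c]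
      exact Real.rpow_le_rpow_of_exponent_le hc (by linarith)
    have h2 : 0 < m * u ^ (1 + α) := by positivity
    nlinarith [mul_le_mul_of_nonneg_left h1 h2.le]
  · refine Real.exp_le_exp.2 ?_
    nlinarith [mul_pos hlam hu]

/-- The function equals `m u^(-α) e^(-lam u)`, and `α < 1` makes the power integrable at the origin.
This first moment is the only integrability of the Lévy measure used below. -/
theorem integrableOn_mul_sideDensity {m α lam : ℝ} (hα : α < 1) (hlam : 0 < lam) :
    IntegrableOn (fun u => u * sideDensity m α lam u) (Set.Ioi 0) := by
  have h := (integrableOn_rpow_mul_exp_neg_mul_rpow (p := 1) (s := -α) (b := lam)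
    (by linarith) one_pos hlam).const_mul m
  refine IntegrableOn.congr_fun h (fun u hu => ?_) measurableSet_Ioi
  have hu : 0 < u := hu
  simp only [sideDensity, Real.rpow_one]
  rw [Real.rpow_add hu, Real.rpow_one, Real.rpow_neg hu.le]
  have : u ^ α ≠ 0 := by positivity
  field_simp

theorem levyDensity_of_pos (p : Params) {u : ℝ} (hu : 0 < u) :
    levyDensity p u = sideDensity p.m₁ p.α₁ p.lam₁ u := by
  simp [levyDensity, sideDensity, hu]

theorem levyDensity_of_neg (p : Params) {u : ℝ} (hu : u < 0) :
    levyDensity p u = sideDensity p.m₂ p.α₂ p.lam₂ (-u) := by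
  simp [levyDensity, sideDensity, hu, hu.le, abs_of_neg]

theorem levyDensity_zero (p : Params) : levyDensity p 0 = 0 := by
  simp [levyDensity]

theorem measurable_levyDensity (p : Params) : Measurable (levyDensity p) := by
  unfold levyDensity
  refine Measurable.ite measurableSet_Ioi (by fun_prop)
    (Measurable.ite measurableSet_Iio (by fun_prop) measurable_const)

theorem levyDensity_nonneg (p : Params) (u : ℝ) : 0 ≤ levyDensity p u := by
  rcases lt_trichotomy u 0 with hu | rfl | hu
  · rw [levyDensity_of_neg p hu]
    exact sideDensity_nonneg p.m₂_pos (neg_pos.2 hu)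
  · exact (levyDensity_zero p).ge
  · rw [levyDensity_of_pos p hu]
    exact sideDensity_nonneg p.m₁_pos hu

/-- Selfdecomposability, on the level of the Lévy density. -/
theorem mul_levyDensity_mul_le (p : Params) {c : ℝ} (hc : 1 ≤ c) (u : ℝ) :
    c * levyDensity p (c * u) ≤ levyDensity p u := by
  have hc0 : 0 < c := by linarith
  rcases lt_trichotomy u 0 with hu | rfl | hu
  · rw [levyDensity_of_neg p hu, levyDensity_of_neg p (mul_neg_of_pos_of_neg hc0 hu), ← mul_neg]
    exact mul_sideDensity_mul_le p.m₂_pos p.α₂_nonneg p.lam₂_pos (neg_pos.2 hu) hc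
  · simp [levyDensity_zero]
  · rw [levyDensity_of_pos p hu, levyDensity_of_pos p (mul_pos hc0 hu)]
    exact mul_sideDensity_mul_le p.m₁_pos p.α₁_nonneg p.lam₁_pos hu hc

theorem integrable_abs_mul_levyDensity (p : Params) :
    Integrable fun u : ℝ => |u| * levyDensity p u := by
  have h1 := (integrable_indicator_iff measurableSet_Ioi).2
    (integrableOn_mul_sideDensity (m := p.m₁) p.α₁_lt_one p.lam₁_pos)
  have h2 := (integrable_indicator_iff measurableSet_Ioi).2
    (integrableOn_mul_sideDensity (m := p.m₂) p.α₂_lt_one p.lam₂_pos)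
  refine (h1.add h2.comp_neg).congr (ae_of_all _ fun u => ?_)
  rcases lt_trichotomy u 0 with hu | rfl | hu
  · simp [Set.indicator, levyDensity_of_neg p hu, hu, hu.le, abs_of_neg]
  · simp
  · simp [Set.indicator, levyDensity_of_pos p hu, hu, hu.le, abs_of_pos]

theorem integral_levyMeasure (p : Params) (f : ℝ → ℂ) :
    ∫ u, f u ∂(levyMeasure p) = ∫ u, f u * levyDensity p u := by
  rw [levyMeasure, integral_withDensity_eq_integral_toReal_smul
    (measurable_levyDensity p).ennreal_ofReal (ae_of_all _ fun _ => ENNReal.ofReal_lt_top)]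
  refine integral_congr_ae (ae_of_all _ fun u => ?_)
  simp [ENNReal.toReal_ofReal (levyDensity_nonneg p u), mul_comm]

theorem integrable_levyMeasure_iff (p : Params) (f : ℝ → ℂ) :
    Integrable f (levyMeasure p) ↔ Integrable fun u => f u * levyDensity p u := by
  rw [levyMeasure, integrable_withDensity_iff_integrable_smul'
    (measurable_levyDensity p).ennreal_ofReal (ae_of_all _ fun _ => ENNReal.ofReal_lt_top)]
  refine integrable_congr (ae_of_all _ fun u => ?_)
  simp [ENNReal.toReal_ofReal (levyDensity_nonneg p u), mul_comm]

/-! ### The characteristic exponent -/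

theorem norm_exp_I_mul_mul_sub_one_le (z u : ℝ) :
    ‖Complex.exp (Complex.I * z * u) - 1‖ ≤ |z| * |u| := by
  have h := Real.norm_exp_I_mul_ofReal_sub_one_le (x := z * u)
  rw [Real.norm_eq_abs, abs_mul] at h
  convert h using 4
  push_cast
  ring

/-- The Lévy–Khintchine integrand is integrable when `|u| r(u)` is. -/
theorem integrable_exp_sub_one_mul {r : ℝ → ℝ} (hr : Measurable r)
    (hi : Integrable fun u => |u| * r u) (z : ℝ) :
    Integrable fun u : ℝ => (Complex.exp (Complex.I * z * u) - 1) * (r u : ℂ) := by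
  refine (hi.norm.const_mul |z|).mono' (by fun_prop) (ae_of_all _ fun u => ?_)
  rw [norm_mul, Complex.norm_real, norm_mul, ← mul_assoc, Real.norm_eq_abs |u|, abs_abs]
  exact mul_le_mul_of_nonneg_right (norm_exp_I_mul_mul_sub_one_le z u) (norm_nonneg _)

/-- The characteristic exponent. -/
def charExp (p : Params) (z : ℝ) : ℂ :=
  ∫ u : ℝ, (Complex.exp (Complex.I * z * u) - 1) * levyDensity p u

/-- The derivative of the characteristic exponent. -/
def charExpDeriv (p : Params) (z : ℝ) : ℂ :=
  ∫ u : ℝ, Complex.I * u * Complex.exp (Complex.I * z * u) * levyDensity p u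

theorem charFn_eq (p : Params) (z : ℝ) : charFn p z = Complex.exp (charExp p z) := by
  rw [charFn, integral_levyMeasure, charExp]

theorem charFn_ne_zero (p : Params) (z : ℝ) : charFn p z ≠ 0 := by
  rw [charFn_eq]
  exact Complex.exp_ne_zero _

theorem norm_charExpDeriv_integrand (p : Params) (z u : ℝ) :
    ‖Complex.I * u * Complex.exp (Complex.I * z * u) * levyDensity p u‖ =
      |u| * levyDensity p u := by
  have h1 : ‖Complex.exp (Complex.I * z * u)‖ = 1 := by
    rw [show Complex.I * z * u = ((z * u : ℝ) : ℂ) * Complex.I by push_cast; ring]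
    exact Complex.norm_exp_ofReal_mul_I _
  simp only [norm_mul, Complex.norm_I, h1, Complex.norm_real, Real.norm_eq_abs, one_mul, mul_one,
    abs_of_nonneg (levyDensity_nonneg p u)]

theorem norm_charExpDeriv_le (p : Params) (z : ℝ) :
    ‖charExpDeriv p z‖ ≤ ∫ u, |u| * levyDensity p u :=
  (norm_integral_le_integral_norm _).trans_eq
    (integral_congr_ae (ae_of_all _ fun u => norm_charExpDeriv_integrand p z u))

theorem hasDerivAt_charExp (p : Params) (z : ℝ) :
    HasDerivAt (charExp p) (charExpDeriv p z) z := by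
  have hm := measurable_levyDensity p
  refine (hasDerivAt_integral_of_dominated_loc_of_deriv_le (s := Set.univ) univ_mem
    (bound := fun u => |u| * levyDensity p u)
    (𝕜 := ℝ) (F := fun z u => (Complex.exp (Complex.I * z * u) - 1) * levyDensity p u)
    (F' := fun z u => Complex.I * u * Complex.exp (Complex.I * z * u) * levyDensity p u)
    (Eventually.of_forall fun z => ?_) ?_ ?_ ?_ (integrable_abs_mul_levyDensity p) ?_).2
  · exact (integrable_exp_sub_one_mul hm (integrable_abs_mul_levyDensity p) z).aestronglyMeasurable
  · exact integrable_exp_sub_one_mul hm (integrable_abs_mul_levyDensity p) z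
  · fun_prop
  · exact ae_of_all _ fun u z _ => (norm_charExpDeriv_integrand p z u).le
  · refine ae_of_all _ fun u z _ => ?_
    have h : HasDerivAt (fun w : ℝ => Complex.I * (w : ℂ) * u) (Complex.I * 1 * u) z :=
      (((hasDerivAt_id z).ofReal_comp).const_mul Complex.I).mul_const _
    convert! (h.cexp.sub_const 1).mul_const (levyDensity p u : ℂ) using 1
    ring

theorem hasDerivAt_charFn (p : Params) (z : ℝ) :
    HasDerivAt (charFn p) (charFn p z * charExpDeriv p z) z := by
  have h := (hasDerivAt_charExp p z).cexp
  simpa only [← charFn_eq] using! h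

theorem continuous_charFn (p : Params) : Continuous (charFn p) :=
  continuous_iff_continuousAt.2 fun z => (hasDerivAt_charFn p z).continuousAt

theorem continuous_charExpDeriv (p : Params) : Continuous (charExpDeriv p) := by
  have hm := measurable_levyDensity p
  refine continuous_of_dominated (bound := fun u => |u| * levyDensity p u)
    (fun x => by fun_prop) (fun z => ae_of_all _ fun u => (norm_charExpDeriv_integrand p z u).le)
    (integrable_abs_mul_levyDensity p) (ae_of_all _ fun u => by fun_prop)

/-! ### Contractive Fourier multipliers -/

/-- Fourier multipliers that are contractive for the supremum norm of `invF h`. -/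
structure IsContractive (m : ℝ → ℂ) : Prop where
  measurable : Measurable m
  norm_le_one : ∀ z, ‖m z‖ ≤ 1
  norm_invF_le : ∀ h : ℝ → ℂ, Integrable h → ∀ C : ℝ, (∀ x, ‖invF h x‖ ≤ C) →
    ∀ x, ‖invF (fun z => h z * m z) x‖ ≤ C

theorem IsContractive.integrable_mul {m : ℝ → ℂ} (hm : IsContractive m) {h : ℝ → ℂ}
    (hh : Integrable h) : Integrable fun z => h z * m z :=
  hh.mul_bdd hm.measurable.aestronglyMeasurable (ae_of_all _ hm.norm_le_one)

theorem IsContractive.one : IsContractive fun _ => 1 :=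
  ⟨measurable_const, fun _ => by simp, fun h _ C hC x => by simpa using hC x⟩

theorem IsContractive.mul {m n : ℝ → ℂ} (hm : IsContractive m) (hn : IsContractive n) :
    IsContractive fun z => m z * n z where
  measurable := hm.measurable.mul hn.measurable
  norm_le_one z := by
    rw [norm_mul]
    exact mul_le_one₀ (hm.norm_le_one z) (norm_nonneg _) (hn.norm_le_one z)
  norm_invF_le h hh C hC := by
    simpa only [mul_assoc] using
      hn.norm_invF_le _ (hm.integrable_mul hh) C (hm.norm_invF_le h hh C hC)

theorem IsContractive.pow {m : ℝ → ℂ} (hm : IsContractive m) (k : ℕ) :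
    IsContractive fun z => m z ^ k := by
  induction k with
  | zero => simpa using IsContractive.one
  | succ k ih => simpa only [pow_succ] using ih.mul hm

/-- Dominated convergence with majorant `‖h‖` passes the pointwise bound on `invF` to the limit. -/
theorem IsContractive.of_tendsto {m : ℕ → ℝ → ℂ} {m' : ℝ → ℂ} (hm : ∀ n, IsContractive (m n))
    (hlim : ∀ z, Tendsto (fun n => m n z) atTop (𝓝 (m' z))) : IsContractive m' where
  measurable := measurable_of_tendsto_metrizable (fun n => (hm n).measurable)
    (tendsto_pi_nhds.2 hlim)
  norm_le_one z := le_of_tendsto (hlim z).norm (Eventually.of_forall fun n => (hm n).norm_le_one z)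
  norm_invF_le h hh C hC x := by
    have key : Tendsto (fun n => invF (fun z => h z * m n z) x) atTop
        (𝓝 (invF (fun z => h z * m' z) x)) := by
      refine tendsto_integral_of_dominated_convergence (fun z => ‖h z‖)
        (fun n => (integrable_mul_exp ((hm n).integrable_mul hh) x).aestronglyMeasurable)
        hh.norm (fun n => ae_of_all _ fun z => ?_)
        (ae_of_all _ fun z => ((hlim z).const_mul _).mul_const _)
      rw [norm_mul, norm_exp_I_mul_mul, mul_one, norm_mul]
      exact mul_le_of_le_one_right (norm_nonneg _) ((hm n).norm_le_one z)
    exact le_of_tendsto key.norm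
      (Eventually.of_forall fun n => (hm n).norm_invF_le h hh C hC x)

/-! ### Multipliers coming from positive measures and Lévy–Khintchine exponents -/

theorem integrable_exp_mul_ofReal {r : ℝ → ℝ} (hr : Integrable r) (z : ℝ) :
    Integrable fun u : ℝ => Complex.exp (Complex.I * z * u) * (r u : ℂ) := by
  refine hr.ofReal.bdd_mul (c := 1) (by fun_prop) (ae_of_all _ fun u => ?_)
  rw [norm_exp_I_mul_mul]

theorem integral_exp_mul_eq_invF (r : ℝ → ℝ) (z : ℝ) :
    ∫ u : ℝ, Complex.exp (Complex.I * z * u) * (r u : ℂ) = invF (fun u => (r u : ℂ)) z := by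
  refine integral_congr_ae (ae_of_all _ fun u => ?_)
  simp only
  rw [mul_comm, mul_right_comm]

/-- Fubini. It serves twice: for contractivity of multipliers, and for the integral term of the
generator. -/
theorem invF_mul_invF {h : ℝ → ℂ} (hh : Integrable h) {k : ℝ → ℂ} (hk : Integrable k) (x : ℝ) :
    invF (fun z => h z * invF k z) x = ∫ u : ℝ, invF h (x + u) * k u := by
  have hprod : Integrable (Function.uncurry fun z u : ℝ =>
      h z * k u * Complex.exp (Complex.I * z * (x + u))) := by
    refine (hh.mul_prod hk).mul_bdd (c := 1) (by fun_prop) (ae_of_all _ fun q => ?_)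
    have := norm_exp_I_mul_mul q.1 (x + q.2)
    push_cast at this
    rw [this]
  have hswap := integral_integral_swap hprod
  calc invF (fun z => h z * invF k z) x
      = ∫ z : ℝ, ∫ u : ℝ, h z * k u * Complex.exp (Complex.I * z * (x + u)) := by
        refine integral_congr_ae (ae_of_all _ fun z => ?_)
        simp only [invF]
        rw [← integral_const_mul, ← integral_mul_const]
        refine integral_congr_ae (ae_of_all _ fun u => ?_)
        simp only
        rw [show Complex.I * (z : ℂ) * (x + u) = Complex.I * u * z + Complex.I * z * x by ring,
          Complex.exp_add]
        ring
    _ = ∫ u : ℝ, ∫ z : ℝ, h z * k u * Complex.exp (Complex.I * z * (x + u)) := hswap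
    _ = ∫ u : ℝ, invF h (x + u) * k u := by
        refine integral_congr_ae (ae_of_all _ fun u => ?_)
        simp only [invF]
        rw [← integral_mul_const]
        refine integral_congr_ae (ae_of_all _ fun z => ?_)
        push_cast
        ring

/-- The Fourier transform of a positive measure of mass at most one is contractive. -/
theorem IsContractive.const_add {r : ℝ → ℝ} (hr : Integrable r) (h0 : ∀ u, 0 ≤ r u) {a : ℝ}
    (ha : 0 ≤ a) (har : a + ∫ u, r u ≤ 1) :
    IsContractive fun z => (a : ℂ) + invF (fun u => (r u : ℂ)) z where
  measurable := ((continuous_invF hr.ofReal).const_add _).measurable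
  norm_le_one z := by
    have h1 := TSD.norm_invF_le (fun u => (r u : ℂ)) z
    simp only [Complex.norm_real, Real.norm_of_nonneg (h0 _)] at h1
    refine (norm_add_le _ _).trans ((add_le_add ?_ h1).trans har)
    rw [Complex.norm_real, Real.norm_of_nonneg ha]
  norm_invF_le h hh C hC x := by
    have hC0 : 0 ≤ C := (norm_nonneg _).trans (hC 0)
    have hr' : Integrable fun u => (r u : ℂ) := hr.ofReal
    have hi : Integrable fun z => h z * invF (fun u => (r u : ℂ)) z :=
      hh.mul_bdd (continuous_invF hr.ofReal).aestronglyMeasurable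
        (ae_of_all _ (TSD.norm_invF_le _))
    have h1 : invF (fun z => h z * ((a : ℂ) + invF (fun u => (r u : ℂ)) z)) x =
        a * invF h x + ∫ u : ℝ, invF h (x + u) * (r u : ℂ) := by
      rw [← invF_mul_invF hh hr', ← invF_smul, ← invF_add (hh.smul _) hi]
      congr 1
      ext z
      simp only [Pi.add_apply, Pi.smul_apply, smul_eq_mul]
      ring
    rw [h1]
    have h2 : ‖∫ u : ℝ, invF h (x + u) * (r u : ℂ)‖ ≤ ∫ u, C * r u := by
      refine norm_integral_le_of_norm_le (hr.const_mul C) (ae_of_all _ fun u => ?_)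
      rw [norm_mul, Complex.norm_real, Real.norm_of_nonneg (h0 u)]
      exact mul_le_mul_of_nonneg_right (hC _) (h0 u)
    rw [integral_const_mul] at h2
    have h3 : ‖(a : ℂ) * invF h x‖ ≤ a * C := by
      rw [norm_mul, Complex.norm_real, Real.norm_of_nonneg ha]
      exact mul_le_mul_of_nonneg_left (hC x) ha
    calc _ ≤ a * C + C * ∫ u, r u := (norm_add_le _ _).trans (add_le_add h3 h2)
      _ = C * (a + ∫ u, r u) := by ring
      _ ≤ C := mul_le_of_le_one_right hC0 har

/-- Characteristic functions of compound Poisson distributions are contractive. -/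
theorem IsContractive.exp_of_integrable {r : ℝ → ℝ} (hr : Integrable r) (h0 : ∀ u, 0 ≤ r u) :
    IsContractive fun z : ℝ =>
      Complex.exp (∫ u : ℝ, (Complex.exp (Complex.I * z * u) - 1) * (r u : ℂ)) := by
  -- Shifting the index by `N` makes the constant term `1 - (∫ r)/(n + N)` nonnegative and the
  -- denominator positive for every `n`. Each factor `1 + ζ/(n + N)` of the approximation to `exp ζ`
  -- is then the Fourier transform of a probability measure.
  obtain ⟨N, hN⟩ := exists_nat_ge (1 + ∫ u, r u)
  have hr0 : 0 ≤ ∫ u, r u := integral_nonneg h0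
  have hζ : ∀ z : ℝ, ∫ u : ℝ, (Complex.exp (Complex.I * z * u) - 1) * (r u : ℂ) =
      invF (fun u => (r u : ℂ)) z - ((∫ u, r u : ℝ) : ℂ) := by
    intro z
    simp only [sub_mul, one_mul]
    have hr' : Integrable fun u => (r u : ℂ) := hr.ofReal
    rw [integral_sub (integrable_exp_mul_ofReal hr z) hr', integral_exp_mul_eq_invF,
      integral_complex_ofReal]
  refine IsContractive.of_tendsto (m := fun n z => (1 + (∫ u : ℝ,
    (Complex.exp (Complex.I * z * u) - 1) * (r u : ℂ)) / ((n + N : ℕ) : ℂ)) ^ (n + N))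
    (fun n => ?_) fun z => (tendsto_add_atTop_iff_nat N).2 (Complex.tendsto_one_add_div_pow_exp _)
  have hpos : (0 : ℝ) < ((n + N : ℕ) : ℝ) := by
    push_cast
    have : (0 : ℝ) ≤ n := n.cast_nonneg
    linarith
  have hle : (∫ u, r u) ≤ ((n + N : ℕ) : ℝ) := by
    push_cast
    have : (0 : ℝ) ≤ n := n.cast_nonneg
    linarith
  have key := IsContractive.const_add (r := fun u => r u / ((n + N : ℕ) : ℝ))
    (a := 1 - (∫ u, r u) / ((n + N : ℕ) : ℝ)) (hr.div_const _)
    (fun u => div_nonneg (h0 u) hpos.le) (sub_nonneg.2 ((div_le_one hpos).2 hle))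
    (by rw [integral_div]; linarith)
  convert key.pow (n + N) using 3 with z
  have h1 : invF (fun u => ((r u / ((n + N : ℕ) : ℝ) : ℝ) : ℂ)) z =
      invF (fun u => (r u : ℂ)) z / ((n + N : ℕ) : ℂ) := by
    rw [div_eq_inv_mul, ← invF_smul]
    congr 1
    ext u
    simp only [Pi.smul_apply, smul_eq_mul]
    push_cast
    ring
  rw [h1, hζ]
  push_cast
  ring

theorem IsContractive.exp_of_integrable_abs_mul {r : ℝ → ℝ} (hr : Measurable r)
    (hi : Integrable fun u => |u| * r u) (h0 : ∀ u, 0 ≤ r u) :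
    IsContractive fun z : ℝ =>
      Complex.exp (∫ u : ℝ, (Complex.exp (Complex.I * z * u) - 1) * (r u : ℂ)) := by
  -- Cutting off the small jumps `|u| < 1/(n+1)` leaves an integrable density, as `r u ≤ (n+1) |u| r
  -- u` on `S n`.
  set S : ℕ → Set ℝ := fun n => {u | 1 ≤ ((n : ℝ) + 1) * |u|} with hS
  have hSm : ∀ n, MeasurableSet (S n) := fun n =>
    measurableSet_le measurable_const (by fun_prop)
  have hint : ∀ n, Integrable ((S n).indicator r) := by
    intro n
    refine (hi.const_mul ((n : ℝ) + 1)).mono' (hr.indicator (hSm n)).aestronglyMeasurable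
      (ae_of_all _ fun u => ?_)
    by_cases hu : u ∈ S n
    · rw [Set.indicator_of_mem hu, Real.norm_of_nonneg (h0 u), ← mul_assoc]
      exact le_mul_of_one_le_left (h0 u) hu
    · rw [Set.indicator_of_notMem hu, norm_zero]
      have := h0 u
      positivity
  refine IsContractive.of_tendsto (fun n => IsContractive.exp_of_integrable (hint n)
    fun u => Set.indicator_nonneg (fun u _ => h0 u) u) fun z => ?_
  refine (Complex.continuous_exp.tendsto _).comp ?_
  refine tendsto_integral_of_dominated_convergence
    (fun u => ‖(Complex.exp (Complex.I * z * u) - 1) * (r u : ℂ)‖) (fun n => ?_)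
    (integrable_exp_sub_one_mul hr hi z).norm (fun n => ae_of_all _ fun u => ?_)
    (ae_of_all _ fun u => ?_)
  · have := (hint n).aestronglyMeasurable
    exact (by fun_prop : AEStronglyMeasurable _ _).mul
      (Complex.continuous_ofReal.comp_aestronglyMeasurable this)
  · rw [norm_mul, norm_mul]
    refine mul_le_mul_of_nonneg_left ?_ (norm_nonneg _)
    rw [Complex.norm_real, Complex.norm_real]
    exact norm_indicator_le_norm_self _ _
  -- The origin lies in no `S n`, but there the factor `e^{izu} - 1` vanishes.
  · rcases eq_or_ne u 0 with rfl | hu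
    · simp
    · refine tendsto_const_nhds.congr' ?_
      obtain ⟨N, hN⟩ := exists_nat_ge (1 / |u|)
      filter_upwards [eventually_ge_atTop N] with n hn
      have hpos : 0 < |u| := abs_pos.2 hu
      have h1 : (N : ℝ) ≤ n := by exact_mod_cast hn
      have : u ∈ S n := by
        rw [div_le_iff₀ hpos] at hN
        change 1 ≤ ((n : ℝ) + 1) * |u|
        nlinarith
      rw [Set.indicator_of_mem this]

/-! ### Quotients of the characteristic function -/

theorem one_le_exp_coe (t : ℝ≥0) : 1 ≤ Real.exp (t : ℝ) := Real.one_le_exp t.2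

theorem charExp_inv_mul (p : Params) {c : ℝ} (hc : 0 < c) (z : ℝ) :
    charExp p (c⁻¹ * z) = ∫ u : ℝ, (Complex.exp (Complex.I * z * u) - 1) *
      ((c * levyDensity p (c * u) : ℝ) : ℂ) := by
  have h := Measure.integral_comp_mul_left (fun v : ℝ =>
    (Complex.exp (Complex.I * ((c⁻¹ * z : ℝ) : ℂ) * v) - 1) * (levyDensity p v : ℂ)) c
  rw [abs_of_pos (inv_pos.2 hc), eq_inv_smul_iff₀ hc.ne'] at h
  rw [charExp, ← h, ← integral_smul]
  refine integral_congr_ae (ae_of_all _ fun u => ?_)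
  have hc' : (c : ℂ) ≠ 0 := by exact_mod_cast hc.ne'
  simp only [Complex.real_smul]
  push_cast
  rw [show Complex.I * ((c : ℂ)⁻¹ * z) * (c * u) = Complex.I * z * u by field_simp]
  ring

/-- The multiplier `φ(z)/φ(z/c)` is contractive for `c ≥ 1`. -/
theorem isContractive_charFn_div (p : Params) {c : ℝ} (hc : 1 ≤ c) :
    IsContractive fun z => charFn p z / charFn p (c⁻¹ * z) := by
  have hc0 : 0 < c := by linarith
  have hm := measurable_levyDensity p
  have hi := integrable_abs_mul_levyDensity p
  have hi' : Integrable fun u => |u| * (c * levyDensity p (c * u)) := by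
    refine (hi.comp_mul_left' hc0.ne').congr (ae_of_all _ fun u => ?_)
    simp only [abs_mul, abs_of_pos hc0]
    ring
  -- This difference is the Lévy density of the quotient; selfdecomposability makes it nonnegative.
  have hr : Measurable fun u => levyDensity p u - c * levyDensity p (c * u) := by fun_prop
  have key := IsContractive.exp_of_integrable_abs_mul hr
    ((hi.sub hi').congr (ae_of_all _ fun u => by simp only [Pi.sub_apply, mul_sub]))
    fun u => sub_nonneg.2 (mul_levyDensity_mul_le p hc u)
  convert key using 2 with z
  rw [charFn_eq, charFn_eq, ← Complex.exp_sub, charExp_inv_mul p hc0, charExp,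
    ← integral_sub (integrable_exp_sub_one_mul hm hi z)
      (integrable_exp_sub_one_mul (by fun_prop) hi' z)]
  congr 2
  ext u
  push_cast
  ring

/-! ### The semigroup -/

/-- The action of the semigroup on Fourier transforms, with `c = e^t`. -/
def evol (p : Params) (c : ℝ) (h : ℝ → ℂ) (w : ℝ) : ℂ :=
  c * h (c * w) * (charFn p (c * w) / charFn p w)

theorem norm_charFn_div_le_one (p : Params) {c : ℝ} (hc : 1 ≤ c) (w : ℝ) :
    ‖charFn p (c * w) / charFn p w‖ ≤ 1 := by
  have h := (isContractive_charFn_div p hc).norm_le_one (c * w)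
  rwa [inv_mul_cancel_left₀ (by positivity)] at h

theorem norm_evol_le (p : Params) {c : ℝ} (hc : 1 ≤ c) (h : ℝ → ℂ) (w : ℝ) :
    ‖evol p c h w‖ ≤ c * ‖h (c * w)‖ := by
  rw [evol, norm_mul, norm_mul, Complex.norm_real, Real.norm_of_nonneg (by positivity)]
  exact mul_le_of_le_one_right (by positivity) (norm_charFn_div_le_one p hc w)

theorem continuous_charFn_div (p : Params) (c : ℝ) :
    Continuous fun w => charFn p (c * w) / charFn p w :=
  ((continuous_charFn p).comp (by fun_prop)).div (continuous_charFn p) (charFn_ne_zero p)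

theorem integrable_evol (p : Params) {c : ℝ} (hc : 1 ≤ c) {h : ℝ → ℂ} (hh : Integrable h) :
    Integrable (evol p c h) :=
  ((hh.comp_mul_left' (by positivity : c ≠ 0)).const_mul (c : ℂ)).mul_bdd
    (continuous_charFn_div p c).aestronglyMeasurable (ae_of_all _ (norm_charFn_div_le_one p hc))

theorem evol_one (p : Params) (h : ℝ → ℂ) : evol p 1 h = h := by
  ext w
  simp [evol, div_self (charFn_ne_zero p w)]

theorem evol_evol (p : Params) (c d : ℝ) (h : ℝ → ℂ) :
    evol p c (evol p d h) = evol p (c * d) h := by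
  ext w
  have h1 := charFn_ne_zero p w
  have h2 := charFn_ne_zero p (c * w)
  simp only [evol]
  rw [← mul_assoc d c w, mul_comm d c]
  push_cast
  field_simp

/-- The substitution `z = c w` factors the evolution into a multiplier, contractive for `c ≥ 1`, and
the dilation `x ↦ c⁻¹ x`, which does not affect uniform bounds. -/
theorem invF_evol (p : Params) {c : ℝ} (hc : 0 < c) (h : ℝ → ℂ) (x : ℝ) :
    invF (evol p c h) x = invF (fun z => h z * (charFn p z / charFn p (c⁻¹ * z))) (c⁻¹ * x) := by
  have key := Measure.integral_comp_mul_left (fun z : ℝ =>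
    h z * (charFn p z / charFn p (c⁻¹ * z)) * Complex.exp (Complex.I * z * (c⁻¹ * x : ℝ))) c
  rw [abs_of_pos (inv_pos.2 hc), eq_inv_smul_iff₀ hc.ne', ← integral_smul] at key
  rw [invF, invF, ← key]
  refine integral_congr_ae (ae_of_all _ fun w => ?_)
  have hc' : (c : ℂ) ≠ 0 := by exact_mod_cast hc.ne'
  simp only [evol, Complex.real_smul, inv_mul_cancel_left₀ hc.ne']
  push_cast
  rw [show Complex.I * (c * w) * ((c : ℂ)⁻¹ * x) = Complex.I * w * x by field_simp]
  ring

/-- `evol` as a linear map. -/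
def evolMap (p : Params) (t : ℝ≥0) : integrableFun →ₗ[ℂ] integrableFun where
  toFun h := ⟨evol p (Real.exp t) h, integrable_evol p (one_le_exp_coe t) h.2⟩
  map_add' h k := by
    ext w
    simp only [evol, Submodule.coe_add, Pi.add_apply]
    ring
  map_smul' a h := by
    ext w
    simp only [evol, Submodule.coe_smul, Pi.smul_apply, smul_eq_mul, RingHom.id_apply]
    ring

theorem coe_evolMap (p : Params) (t : ℝ≥0) (h : integrableFun) :
    (evolMap p t h : ℝ → ℂ) = evol p (Real.exp t) h := rfl

theorem norm_invFMap_evolMap_le (p : Params) (t : ℝ≥0) (h : integrableFun) :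
    ‖(invFMap ∘ₗ evolMap p t) h‖ ≤ 1 * ‖invFMap h‖ := by
  rw [one_mul]
  refine norm_le_of_forall_le (norm_nonneg _) fun x => ?_
  rw [LinearMap.comp_apply, invFMap_apply, coe_evolMap, invF_evol p (Real.exp_pos _)]
  exact (isContractive_charFn_div p (one_le_exp_coe t)).norm_invF_le h h.2 _
    (fun y => (invFMap h : ℝ →ᵇ ℂ).norm_coe_le_norm y) _

/-- The transition semigroup. -/
def semigroup (p : Params) (t : ℝ≥0) : schwartzClosure →L[ℂ] schwartzClosure :=
  (invFMap ∘ₗ evolMap p t).extendOfNorm invFMap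

theorem semigroup_invFMap (p : Params) (t : ℝ≥0) (h : integrableFun) :
    semigroup p t (invFMap h) = invFMap (evolMap p t h) :=
  LinearMap.extendOfNorm_eq denseRange_invFMap ⟨1, norm_invFMap_evolMap_le p t⟩ h

theorem norm_semigroup_apply_le (p : Params) (t : ℝ≥0) (f : schwartzClosure) :
    ‖semigroup p t f‖ ≤ ‖f‖ :=
  (LinearMap.norm_extendOfNorm_apply_le denseRange_invFMap 1
    (norm_invFMap_evolMap_le p t) f).trans_eq (one_mul _)

theorem ext_of_invFMap {A B : schwartzClosure →L[ℂ] schwartzClosure}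
    (h : ∀ k, A (invFMap k) = B (invFMap k)) : A = B :=
  ContinuousLinearMap.ext fun f =>
    congrFun (denseRange_invFMap.equalizer A.continuous B.continuous (funext h)) f

theorem semigroup_zero (p : Params) : semigroup p 0 = ContinuousLinearMap.id ℂ _ := by
  refine ext_of_invFMap fun k => ?_
  rw [semigroup_invFMap, ContinuousLinearMap.id_apply]
  congr 1
  ext1
  rw [coe_evolMap, NNReal.coe_zero, Real.exp_zero, evol_one]

theorem semigroup_add (p : Params) (s t : ℝ≥0) :
    semigroup p (s + t) = (semigroup p s).comp (semigroup p t) := by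
  refine ext_of_invFMap fun k => ?_
  rw [ContinuousLinearMap.comp_apply, semigroup_invFMap, semigroup_invFMap, semigroup_invFMap]
  congr 1
  ext1
  rw [coe_evolMap, coe_evolMap, coe_evolMap, NNReal.coe_add, Real.exp_add, evol_evol]

theorem isGivenByFormula_semigroup (p : Params) : IsGivenByFormula p (semigroup p) := by
  intro t f hf hf' x
  set F := fourierT (f : ℝ →ᵇ ℂ) with hF
  set k : integrableFun := ⟨(1 / (2 * (Real.pi : ℂ))) • F, Integrable.smul _ hf'⟩ with hk
  -- By Fourier inversion `f` lies in the range of `invFMap`, where the extension is explicit.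
  have hfk : f = invFMap k := by
    refine Subtype.ext (BoundedContinuousFunction.ext fun y => ?_)
    exact (invF_fourierT (f : ℝ →ᵇ ℂ).continuous hf hf' y).symm
  have hm := isContractive_charFn_div p (one_le_exp_coe t)
  have hI : semigroupIntegrand p t (f : ℝ →ᵇ ℂ) x = fun z : ℝ =>
      F z * (charFn p z / charFn p ((Real.exp t)⁻¹ * z)) *
        Complex.exp (Complex.I * z * ((Real.exp t)⁻¹ * x : ℝ)) := by
    ext z
    simp only [semigroupIntegrand, Real.exp_neg]
    rw [mul_right_comm]
    congr 2
    push_cast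
    ring
  refine ⟨?_, ?_⟩
  · rw [hI]
    exact integrable_mul_exp (hm.integrable_mul hf') _
  · rw [hI]
    conv_lhs => rw [hfk, semigroup_invFMap, invFMap_apply, coe_evolMap, invF_evol p (Real.exp_pos _)]
    rw [← integral_const_mul]
    refine integral_congr_ae (ae_of_all _ fun z => ?_)
    simp only [hk, Pi.smul_apply, smul_eq_mul]
    ring

theorem integrable_fourierT (f : 𝓢(ℝ, ℂ)) : Integrable (fourierT f) := by
  have h := (FourierTransform.fourier f).integrable.comp_div (g := FourierTransform.fourier f)
    (R := 2 * Real.pi) (by positivity)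
  refine h.congr (ae_of_all _ fun u => ?_)
  rw [fourierT_eq_fourier]
  rfl

theorem IsGivenByFormula.unique {p : Params} {P Q : ℝ≥0 → (schwartzClosure →L[ℂ] schwartzClosure)}
    (hP : IsGivenByFormula p P) (hQ : IsGivenByFormula p Q) : Q = P := by
  funext t
  refine ContinuousLinearMap.ext fun f => congrFun
    (denseRange_ofSchwartz.equalizer (Q t).continuous (P t).continuous (funext fun g => ?_)) f
  refine Subtype.ext (BoundedContinuousFunction.ext fun x => ?_)
  have h1 := (hP t (ofSchwartz g) g.integrable (integrable_fourierT g) x).2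
  have h2 := (hQ t (ofSchwartz g) g.integrable (integrable_fourierT g) x).2
  exact h2.trans h1.symm

/-! ### The generator -/

/-- The decay estimates of orders `n` and `n + 2` add up to a bound by the integrable weight `(1 +
v²)⁻¹`. -/
theorem exists_pow_mul_norm_le_div (h : 𝓢(ℝ, ℂ)) (n : ℕ) :
    ∃ C, ∀ v : ℝ, |v| ^ n * ‖h v‖ ≤ C * (1 + v ^ 2)⁻¹ := by
  obtain ⟨C, -, hC⟩ := h.decay n 0
  obtain ⟨D, -, hD⟩ := h.decay (n + 2) 0
  refine ⟨C + D, fun v => ?_⟩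
  have h1 := hC v
  have h2 := hD v
  simp only [norm_iteratedFDeriv_zero, Real.norm_eq_abs] at h1 h2
  rw [← div_eq_mul_inv, le_div_iff₀ (by positivity)]
  rw [pow_add, sq_abs] at h2
  linarith

/-- The Fourier side of the generator. -/
def genDensity (p : Params) (h : ℝ → ℂ) (w : ℝ) : ℂ :=
  h w + w * deriv h w + w * h w * charExpDeriv p w

theorem continuous_genDensity (p : Params) (h : 𝓢(ℝ, ℂ)) : Continuous (genDensity p h) := by
  have h1 : Continuous (deriv h) := (SchwartzMap.derivCLM ℝ ℂ h).continuous
  have h2 := continuous_charExpDeriv p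
  have h3 := h.continuous
  unfold genDensity
  fun_prop

theorem exists_norm_genDensity_le (p : Params) (h : 𝓢(ℝ, ℂ)) :
    ∃ C, ∀ v, ‖genDensity p h v‖ ≤ C * (1 + v ^ 2)⁻¹ := by
  obtain ⟨C₀, h₀⟩ := exists_pow_mul_norm_le_div h 0
  obtain ⟨C₁, h₁⟩ := exists_pow_mul_norm_le_div h 1
  obtain ⟨C₂, h₂⟩ := exists_pow_mul_norm_le_div (SchwartzMap.derivCLM ℝ ℂ h) 1
  set K := ∫ u, |u| * levyDensity p u with hK
  refine ⟨C₀ + C₂ + C₁ * K, fun v => ?_⟩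
  have a := h₀ v
  have b := h₁ v
  have c := h₂ v
  simp only [pow_zero, pow_one, one_mul, SchwartzMap.derivCLM_apply] at a b c
  have d : ‖(v : ℂ) * h v * charExpDeriv p v‖ ≤ C₁ * (1 + v ^ 2)⁻¹ * K := by
    rw [norm_mul, norm_mul, Complex.norm_real, Real.norm_eq_abs]
    exact mul_le_mul b (norm_charExpDeriv_le p v) (norm_nonneg _)
      ((mul_nonneg (abs_nonneg _) (norm_nonneg _)).trans b)
  have e : ‖(v : ℂ) * deriv h v‖ ≤ C₂ * (1 + v ^ 2)⁻¹ := by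
    rwa [norm_mul, Complex.norm_real, Real.norm_eq_abs]
  refine (norm_add₃_le ..).trans ((add_le_add_three a e d).trans_eq ?_)
  ring

theorem integrable_genDensity (p : Params) (h : 𝓢(ℝ, ℂ)) : Integrable (genDensity p h) := by
  obtain ⟨C, hC⟩ := exists_norm_genDensity_le p h
  exact (integrable_inv_one_add_sq.const_mul C).mono'
    (continuous_genDensity p h).aestronglyMeasurable (ae_of_all _ hC)

/-- The derivative at every `s`, not only at `0`, is the evolution of `genDensity`; this is what
allows a mean value estimate of the difference quotients. -/
theorem hasDerivAt_evol_exp (p : Params) {h : ℝ → ℂ} (hh : Differentiable ℝ h) (w s : ℝ) :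
    HasDerivAt (fun s => evol p (Real.exp s) h w) (evol p (Real.exp s) (genDensity p h) w) s := by
  have h1 : HasDerivAt (fun s => Real.exp s * w) (Real.exp s * w) s :=
    (Real.hasDerivAt_exp s).mul_const w
  have h2 : HasDerivAt (fun s => h (Real.exp s * w))
      ((Real.exp s * w : ℝ) • deriv h (Real.exp s * w)) s :=
    (hh _).hasDerivAt.scomp s h1
  have h3 := (hasDerivAt_charFn p (Real.exp s * w)).scomp s h1
  have h4 := (((Real.hasDerivAt_exp s).ofReal_comp).mul h2).mul (h3.div_const (charFn p w))
  convert! h4 using 1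
  simp only [evol, genDensity, Complex.real_smul, Function.comp_apply, Pi.mul_apply]
  push_cast
  ring

theorem exists_norm_evol_genDensity_le (p : Params) (h : 𝓢(ℝ, ℂ)) :
    ∃ C, ∀ s ∈ Set.Icc (0 : ℝ) 1, ∀ w,
      ‖evol p (Real.exp s) (genDensity p h) w‖ ≤ C * (1 + w ^ 2)⁻¹ := by
  obtain ⟨C, hC⟩ := exists_norm_genDensity_le p h
  have hC0 : 0 ≤ C := by simpa using (norm_nonneg _).trans (hC 0)
  refine ⟨Real.exp 1 * C, fun s hs w => ?_⟩
  have h1 : 1 ≤ Real.exp s := Real.one_le_exp hs.1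
  refine (norm_evol_le p h1 _ w).trans ?_
  rw [mul_assoc]
  refine mul_le_mul (Real.exp_le_exp.2 hs.2) ((hC _).trans ?_) (norm_nonneg _) (Real.exp_pos _).le
  refine mul_le_mul_of_nonneg_left (inv_anti₀ (by positivity) ?_) hC0
  rw [mul_pow]
  have : 1 ≤ Real.exp s ^ 2 := one_le_pow₀ h1
  nlinarith [sq_nonneg w]

theorem tendsto_coe_nhdsGT_zero :
    Tendsto (fun t : ℝ≥0 => (t : ℝ)) (𝓝[>] 0) (𝓝[>] 0) := by
  refine tendsto_nhdsWithin_iff.2 ⟨?_, ?_⟩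
  · exact (NNReal.continuous_coe.tendsto' 0 0 rfl).mono_left nhdsWithin_le_nhds
  · filter_upwards [self_mem_nhdsWithin] with t ht
    exact NNReal.coe_pos.2 ht

theorem tendsto_integral_norm_evol (p : Params) (h : 𝓢(ℝ, ℂ)) :
    Tendsto (fun t : ℝ≥0 => ∫ w, ‖((t : ℝ) : ℂ)⁻¹ * (evol p (Real.exp t) h w - h w) -
      genDensity p h w‖) (𝓝[>] 0) (𝓝 0) := by
  obtain ⟨C, hC⟩ := exists_norm_evol_genDensity_le p h
  have hd := fun w s => hasDerivAt_evol_exp p h.differentiable w s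
  have hg : ∀ w, ‖genDensity p h w‖ ≤ C * (1 + w ^ 2)⁻¹ := fun w => by
    simpa [evol_one] using hC 0 (by simp) w
  have hev : ∀ᶠ t : ℝ≥0 in 𝓝[>] 0, t ∈ Set.Ioc (0 : ℝ≥0) 1 :=
    Ioc_mem_nhdsGT one_pos
  rw [← integral_zero ℝ ℝ]
  refine tendsto_integral_filter_of_dominated_convergence
    (fun w => C * (1 + w ^ 2)⁻¹ + C * (1 + w ^ 2)⁻¹) ?_ ?_
    ((integrable_inv_one_add_sq.const_mul C).add (integrable_inv_one_add_sq.const_mul C))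
    (ae_of_all _ fun w => ?_)
  · refine Eventually.of_forall fun t => ?_
    exact (((((integrable_evol p (one_le_exp_coe t) h.integrable).sub h.integrable).const_mul
      _).sub (integrable_genDensity p h)).norm).aestronglyMeasurable
  · filter_upwards [hev] with t ht
    have ht0 : (0 : ℝ) < t := NNReal.coe_pos.2 ht.1
    have ht1 : (t : ℝ) ≤ 1 := by exact_mod_cast ht.2
    refine ae_of_all _ fun w => ?_
    rw [norm_norm]
    refine (norm_sub_le _ _).trans (add_le_add ?_ (hg w))
    -- The mean value inequality on `[0, t] ⊆ [0, 1]` gives a majorant of the difference quotient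
    -- independent of `t`.
    have h1 := norm_image_sub_le_of_norm_deriv_le_segment'
      (f := fun s => evol p (Real.exp s) h w) (a := 0) (b := (t : ℝ)) (C := C * (1 + w ^ 2)⁻¹)
      (fun s _ => (hd w s).hasDerivWithinAt) (fun s hs => hC s ⟨hs.1, hs.2.le.trans ht1⟩ w)
      t ⟨ht0.le, le_rfl⟩
    simp only [Real.exp_zero, evol_one, sub_zero] at h1
    rw [norm_mul, norm_inv, Complex.norm_real, Real.norm_of_nonneg ht0.le, inv_mul_le_iff₀ ht0]
    linarith
  · have h1 := (hd w 0).tendsto_slope_zero_right.comp tendsto_coe_nhdsGT_zero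
    simp only [Real.exp_zero, evol_one, Function.comp_def, zero_add] at h1
    have h2 := (h1.sub_const (genDensity p h w)).norm
    simpa [Complex.real_smul] using h2

theorem hasGeneratorAt_semigroup (p : Params) (h : 𝓢(ℝ, ℂ)) :
    HasGeneratorAt (semigroup p) (invFMap ⟨h, h.integrable⟩)
      (invFMap ⟨genDensity p h, integrable_genDensity p h⟩) := by
  rw [HasGeneratorAt, tendsto_iff_norm_sub_tendsto_zero]
  refine squeeze_zero (fun _ => norm_nonneg _) (fun t => ?_) (tendsto_integral_norm_evol p h)
  rw [semigroup_invFMap, ← map_sub, ← map_smul, ← map_sub]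
  exact norm_invFMap_le _

theorem isC0Semigroup_semigroup (p : Params) : IsC0Semigroup (semigroup p) where
  zero := semigroup_zero p
  add := semigroup_add p
  tendsto_zero := by
    have hS : ∀ k : 𝓢(ℝ, ℂ), Tendsto (fun t : ℝ≥0 => semigroup p t (ofSchwartz k)) (𝓝[>] 0)
        (𝓝 (ofSchwartz k)) := by
      intro k
      obtain ⟨h, hh⟩ := exists_invFMap_eq_ofSchwartz k
      have h1 := hasGeneratorAt_semigroup p h
      rw [hh] at h1
      have h2 : Tendsto (fun t : ℝ≥0 => ((t : ℝ) : ℂ)) (𝓝[>] 0) (𝓝 0) :=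
        (Complex.continuous_ofReal.tendsto' 0 0 Complex.ofReal_zero).comp
          (tendsto_coe_nhdsGT_zero.mono_right nhdsWithin_le_nhds)
      -- On Schwartz functions `P_t k - k` is `t` times a convergent difference quotient, hence
      -- tends to `0`.
      have h3 := (h2.smul h1).add_const (ofSchwartz k)
      rw [zero_smul, zero_add] at h3
      refine h3.congr' ?_
      filter_upwards [self_mem_nhdsWithin] with t ht
      have : ((t : ℝ) : ℂ) ≠ 0 := by exact_mod_cast (NNReal.coe_pos.2 ht).ne'
      rw [smul_inv_smul₀ this, sub_add_cancel]
    intro f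
    rw [Metric.tendsto_nhds]
    intro ε hε
    -- Contractivity gives the same error `ε / 3` after applying `P_t`, uniformly in `t`.
    obtain ⟨k, hk⟩ := denseRange_ofSchwartz.exists_dist_lt f (by positivity : 0 < ε / 3)
    filter_upwards [Metric.tendsto_nhds.1 (hS k) (ε / 3) (by positivity)] with t ht
    have h1 : dist (semigroup p t f) (semigroup p t (ofSchwartz k)) < ε / 3 := by
      rw [dist_eq_norm, ← map_sub]
      exact (norm_semigroup_apply_le p t _).trans_lt (by rwa [← dist_eq_norm])
    have h2 := dist_triangle4 (semigroup p t f) (semigroup p t (ofSchwartz k)) (ofSchwartz k) f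
    rw [dist_comm] at hk
    linarith

/-! ### The generator in the space variable -/

theorem hasDerivAt_invF {h : ℝ → ℂ} (hh : Integrable h)
    (hh' : Integrable fun w : ℝ => (w : ℂ) * h w) (x : ℝ) :
    HasDerivAt (invF h) (Complex.I * invF (fun w : ℝ => (w : ℂ) * h w) x) x := by
  have key := (hasDerivAt_integral_of_dominated_loc_of_deriv_le (s := Set.univ) (x₀ := x)
    (𝕜 := ℝ) (μ := volume) univ_mem (bound := fun w : ℝ => ‖(w : ℂ) * h w‖)
    (F := fun x w : ℝ => h w * Complex.exp (Complex.I * w * x))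
    (F' := fun x w : ℝ => Complex.I * ((w : ℂ) * h w * Complex.exp (Complex.I * w * x)))
    (Eventually.of_forall fun x => (integrable_mul_exp hh x).aestronglyMeasurable)
    (integrable_mul_exp hh x) ((integrable_mul_exp hh' x).const_mul _).aestronglyMeasurable
    (ae_of_all _ fun w x _ => ?_) hh'.norm (ae_of_all _ fun w x _ => ?_)).2
  · rwa [integral_const_mul] at key
  · rw [norm_mul, norm_mul, norm_exp_I_mul_mul, Complex.norm_I, one_mul, mul_one]
  · have h1 : HasDerivAt (fun y : ℝ => Complex.I * w * (y : ℂ)) (Complex.I * w * 1) x :=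
      ((hasDerivAt_id x).ofReal_comp).const_mul _
    convert! h1.cexp.const_mul (h w) using 1
    ring

theorem integrable_ofReal_mul_schwartz (h : 𝓢(ℝ, ℂ)) :
    Integrable fun w : ℝ => (w : ℂ) * h w := by
  refine (h.integrable_pow_mul volume 1).mono'
    ((by fun_prop : Continuous fun w : ℝ => (w : ℂ)).mul h.continuous).aestronglyMeasurable
    (ae_of_all _ fun w => ?_)
  simp

/-- The left density is the derivative of `w h(w)`; integration by parts against `e^{iwx}` has no
boundary terms. Up to `invF h = f`, the right side is `-x f'(x)`. -/
theorem invF_deriv_mul_self (h : 𝓢(ℝ, ℂ)) (x : ℝ) :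
    invF (fun w => h w + w * deriv h w) x =
      -(Complex.I * x * invF (fun w : ℝ => (w : ℂ) * h w) x) := by
  have hk := integrable_ofReal_mul_schwartz h
  have hk' : Integrable fun w : ℝ => h w + w * deriv h w :=
    h.integrable.add (integrable_ofReal_mul_schwartz (SchwartzMap.derivCLM ℝ ℂ h))
  have h1 : ∀ w : ℝ, HasDerivAt (fun w : ℝ => (w : ℂ) * h w) (h w + w * deriv h w) w := by
    intro w
    have := ((hasDerivAt_id w).ofReal_comp).mul (h.differentiable w).hasDerivAt
    simpa using! this
  have h2 : ∀ w : ℝ, HasDerivAt (fun w : ℝ => Complex.exp (Complex.I * w * x))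
      (Complex.exp (Complex.I * w * x) * (Complex.I * x)) w := by
    intro w
    have : HasDerivAt (fun y : ℝ => Complex.I * (y : ℂ) * x) (Complex.I * 1 * x) w :=
      (((hasDerivAt_id w).ofReal_comp).const_mul _).mul_const _
    simpa using this.cexp
  have key := integral_mul_deriv_eq_deriv_mul_of_integrable (fun w _ => h1 w) (fun w _ => h2 w)
    (((integrable_mul_exp hk x).mul_const (Complex.I * x)).congr
      (ae_of_all _ fun w => by simp only [Pi.mul_apply, mul_assoc]))
    (integrable_mul_exp hk' x) (integrable_mul_exp hk x)
  rw [invF, ← neg_eq_iff_eq_neg, ← key, invF, ← integral_const_mul]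
  refine integral_congr_ae (ae_of_all _ fun w => ?_)
  simp only
  ring

theorem integrable_charExpDeriv_density (p : Params) :
    Integrable fun u : ℝ => Complex.I * u * (levyDensity p u : ℂ) := by
  have hm := measurable_levyDensity p
  refine (integrable_abs_mul_levyDensity p).mono' (by fun_prop) (ae_of_all _ fun u => ?_)
  simp [abs_of_nonneg (levyDensity_nonneg p u)]

/-- In this form `invF_mul_invF` turns multiplication by `charExpDeriv` into integration of
translates against `i u ν(du)`. -/
theorem charExpDeriv_eq_invF (p : Params) (z : ℝ) :
    charExpDeriv p z = invF (fun u : ℝ => Complex.I * u * (levyDensity p u : ℂ)) z := by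
  refine integral_congr_ae (ae_of_all _ fun u => ?_)
  simp only
  rw [mul_right_comm, mul_right_comm Complex.I (z : ℂ)]

theorem invF_genDensity (p : Params) {h f : 𝓢(ℝ, ℂ)} (hf : ∀ x, invF h x = f x) (x : ℝ) :
    Integrable (fun u : ℝ => (u : ℂ) * deriv f (x + u)) (levyMeasure p) ∧
      invF (genDensity p h) x = -(x : ℂ) * deriv f x +
        ∫ u : ℝ, (u : ℂ) * deriv f (x + u) ∂(levyMeasure p) := by
  have hk := integrable_ofReal_mul_schwartz h
  have hf' : ∀ y, deriv f y = Complex.I * invF (fun w : ℝ => (w : ℂ) * h w) y := by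
    intro y
    rw [← (hasDerivAt_invF h.integrable hk y).deriv]
    exact congrArg (fun F : ℝ → ℂ => deriv F y) (funext hf).symm
  have hi := integrable_charExpDeriv_density p
  refine ⟨?_, ?_⟩
  · rw [integrable_levyMeasure_iff]
    refine (hi.bdd_mul (f := fun u => invF (fun w : ℝ => (w : ℂ) * h w) (x + u))
      ((continuous_invF hk).comp (by fun_prop)).aestronglyMeasurable
      (ae_of_all _ fun u => norm_invF_le _ _)).congr (ae_of_all _ fun u => ?_)
    simp only [hf']
    ring
  · rw [integral_levyMeasure]
    have h1 : genDensity p h = (fun w => h w + w * deriv h w) + fun w : ℝ => (w : ℂ) * h w *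
        invF (fun u : ℝ => Complex.I * u * (levyDensity p u : ℂ)) w := by
      ext w
      simp only [genDensity, Pi.add_apply, charExpDeriv_eq_invF]
    have h2 : Integrable fun w : ℝ => (w : ℂ) * h w *
        invF (fun u : ℝ => Complex.I * u * (levyDensity p u : ℂ)) w :=
      hk.mul_bdd (continuous_invF hi).aestronglyMeasurable (ae_of_all _ (norm_invF_le _))
    have h3 : Integrable fun w : ℝ => h w + w * deriv h w :=
      h.integrable.add (integrable_ofReal_mul_schwartz (SchwartzMap.derivCLM ℝ ℂ h))
    rw [h1, invF_add h3 h2, invF_deriv_mul_self, invF_mul_invF hk hi, hf']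
    congr 1
    · ring
    · refine integral_congr_ae (ae_of_all _ fun u => ?_)
      simp only [hf']
      ring

end TSD

end

theorem mainTheorem6 (p : TSD.Params) :
    ∃ P : ℝ≥0 → (TSD.schwartzClosure →L[ℂ] TSD.schwartzClosure),
      TSD.IsGivenByFormula p P ∧
      (∀ Q : ℝ≥0 → (TSD.schwartzClosure →L[ℂ] TSD.schwartzClosure),
        TSD.IsGivenByFormula p Q → Q = P) ∧
      TSD.IsC0Semigroup P ∧
      ∀ f : 𝓢(ℝ, ℂ), ∃ hf : TSD.ofSchwartz f ∈ (TSD.generator P).domain,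
        ∀ x : ℝ,
          Integrable (fun u : ℝ => (u : ℂ) * deriv f (x + u)) (TSD.levyMeasure p) ∧
          (TSD.generator P ⟨TSD.ofSchwartz f, hf⟩ : ℝ →ᵇ ℂ) x =
            -(x : ℂ) * deriv f x +
              ∫ u : ℝ, (u : ℂ) * deriv f (x + u) ∂(TSD.levyMeasure p) := by
  refine ⟨TSD.semigroup p, TSD.isGivenByFormula_semigroup p,
    fun Q hQ => (TSD.isGivenByFormula_semigroup p).unique hQ, TSD.isC0Semigroup_semigroup p,
    fun f => ?_⟩
  obtain ⟨h, hh⟩ := TSD.exists_schwartz_invF_eq f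
  have hf : TSD.invFMap ⟨h, h.integrable⟩ = TSD.ofSchwartz f :=
    Subtype.ext (BoundedContinuousFunction.ext hh)
  have hgen := TSD.hasGeneratorAt_semigroup p h
  rw [hf] at hgen
  have hdom : TSD.ofSchwartz f ∈ (TSD.generator (TSD.semigroup p)).domain := ⟨_, hgen⟩
  refine ⟨hdom, fun x => ?_⟩
  obtain ⟨h1, h2⟩ := TSD.invF_genDensity p hh x
  -- The value of `generator` is a chosen limit; uniqueness of limits identifies it with the
  -- explicit one.
  have h3 := (TSD.hasGeneratorAt_generator (TSD.semigroup p) ⟨_, hdom⟩).unique hgen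
  refine ⟨h1, ?_⟩
  rw [h3, TSD.invFMap_apply]
  exact h2
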